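/- Setting. Let $G=(V,E)$ be a finite directed graph, $p:E\to[0,1]$, and $T\subseteq V$ a set of seeds; write $n'=|V\setminus T|$. In the independent cascade (IC) model with initially active set $S$, each node $u$ that became active in the previous step gets one chance to activate each inactive out-neighbour $v$, which succeeds, independently of all other attempts, with probability $p(u,v)$. The diffusion is run either until no new node is activated (complete termination), or for exactly $K$ steps for a given $K$. For $S\subseteq T$ let $U(S)$ be the expected number of nodes of $V\setminus T$ that are activated by $S$ in the graph obtained from $G$ by deleting the seeds of $T\setminus S$ and all their edges. The Shapley value of a seed $t\in T$ is $$Shap(t)=\frac1{|T|!}\sum_{\pi}\bigl[U(S_{\pi,t}\cup\{t\})-U(S_{\pi,t})\bigr],$$ where $\pi$ ranges over the orderings of $T$ and $S_{\pi,t}$ is the set of seeds before $t$ in $\pi$. Let $Shap^{(k)}$ be the $k$-th largest of the values $Shap(t)$, $t\in T$, counted with multiplicity. Algorithm $\mathsf{ApproxRRset}(G,T,p,\varepsilon,\ell,k)$. Let $G'$ be $G$ without the edges into $T$. A random RR set is generated by drawing $v\in V\setminus T$ uniformly, keeping each edge $e$ of $G'$ independently with probability $p(e)$, and taking all nodes that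 can reach $v$ along kept edges (by a path of at most $K$ edges, if the diffusion is stopped after $K$ steps). To record an RR set $R$ with $R\cap T\neq\emptyset$ means to add $1/|R\cap T|$ to the counter $est_t$ of each $t\in R\cap T$. All RR sets are drawn independently. Phase 1. Set $LB=1$, $\varepsilon'=\sqrt2\,\varepsilon$, $\theta_0=0$, and all $est_t=0$. For $i=1,\dots,\lfloor\log_2 n'\rfloor-1$: let $x_i=n'/2^i$ and $$\theta_i=\left\lceil\frac{n'(2+\frac23\varepsilon')}{\varepsilon'^2x_i}\bigl(\ell\ln n'+\ln|T|+\ln\log_2n'+\ln2\bigr)\right\rceil;$$ draw and record $\theta_i-\theta_{i-1}$ new RR sets; let $est^{(k)}$ be the $k$-th largest counter; if $n'\,est^{(k)}/\theta_i\ge(1+\varepsilon')x_i$, set $LB=n'\,est^{(k)}/(\theta_i(1+\varepsilon'))$ and leave the loop. Phase 2. Let $$\theta=\left\lceil\frac{n'(2+\frac23\varepsilon)}{\varepsilon^2LB}\bigl(\ell\ln n'+\ln|T|+\ln4\bigr)\right\rceil,$$ reset all counters to $0$, draw and record $\theta$ new RR sets, and return $\widehat{Shap}(t)=n'\,est_t/\theta$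 for all $t\in T$. Proposition. For any $\varepsilon>0$, $\ell>0$ and $k\in\{1,\dots,|T|\}$, suppose that $Shap^{(k)}\ge1$. Then, under either termination rule, with probability at least $1-1/(n')^{\ell}$ the values $\widehat{Shap}(t)$ returned by $\mathsf{ApproxRRset}$ satisfy, simultaneously for all $t\in T$, $$\begin{cases}|\widehat{Shap}(t)-Shap(t)|\le\varepsilon\,Shap(t)&\text{if }Shap(t)>Shap^{(k)},\\|\widehat{Shap}(t)-Shap(t)|\le\varepsilon\,Shap^{(k)}&\text{if }Shap(t)\le Shap^{(k)}.\end{cases}$$ -/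

import Mathlib

open Finset

/-- A directed network with edge set `edges ⊆ V × V` and activation probabilities in `[0, 1]`.
Only the values of `prob` on `edges` matter. -/
structure Network (V : Type*) where
  edges : Finset (V × V)
  prob : V × V → unitInterval

/-- How a diffusion ends: after a fixed number of steps, or when no new node is activated. -/
inductive Termination where
  | steps (K : ℕ)
  | complete

noncomputable section

namespace Network

variable {V : Type*} [DecidableEq V]

/-- Probability that exactly the edges in `g` succeed, for independent attempts on all edges. -/
def liveWeight (G : Network V) (g : Finset (V × V)) : ENNReal :=
  (∏ e ∈ g, ENNReal.ofReal (G.prob e)) * ∏ e ∈ G.edges \ g, ENNReal.ofReal (1 - G.prob e)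

theorem sum_liveWeight (G : Network V) : ∑ g ∈ G.edges.powerset, G.liveWeight g = 1 := by
  unfold liveWeight
  rw [← Finset.prod_add]
  refine Finset.prod_eq_one fun e _ => ?_
  rw [← ENNReal.ofReal_add (G.prob e).2.1 (sub_nonneg.2 (G.prob e).2.2)]
  simp

/-- The random live-edge graph: every edge `e` of `G` is kept independently with probability
`p(e)` and removed with probability `1 - p(e)`. -/
def liveEdges (G : Network V) : PMF (Finset (V × V)) :=
  PMF.ofFinset (fun g => if g ∈ G.edges.powerset then G.liveWeight g else 0) G.edges.powerset
    (by rw [← G.sum_liveWeight]; exact Finset.sum_congr rfl fun g hg => if_pos hg)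
    (fun _ hg => if_neg hg)

variable [Fintype V]

/-! ### The independent cascade

A state is a pair `(A, N)`: the active nodes and the nodes newly activated in the last step. -/

/-- One step: every `u ∈ N` attempts to activate each out-neighbour `v ∉ A`, the attempts being
independent with success probability `p(u, v)`. Fresh outcomes are drawn in every step, and only
those on edges that leave `N` are used, so each edge is attempted at most once in a diffusion. -/
def icStep (G : Network V) (s : Finset V × Finset V) : PMF (Finset V × Finset V) :=
  G.liveEdges.map fun g =>
    let N' := univ.filter fun v => v ∉ s.1 ∧ ∃ u ∈ s.2, (u, v) ∈ g
    (s.1 ∪ N', N')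

/-- The state after `K` steps, from the initially active nodes `S`. -/
def icState (G : Network V) (S : Finset V) : ℕ → PMF (Finset V × Finset V)
  | 0 => PMF.pure (S, S)
  | K + 1 => (G.icState S K).bind G.icStep

/-- The subgraph `G_{T,S}`: all edges incident to a node of `T \ S` are removed (these nodes are
then isolated and inactive, which is the same as deleting them). -/
def restrictSeeds (G : Network V) (T S : Finset V) : Network V where
  edges := G.edges.filter fun e => e.1 ∉ T \ S ∧ e.2 ∉ T \ S
  prob := G.prob

/-- Number of steps a diffusion is run; for `complete` it is `|V \ T|`, by which time it has
stopped, since every step before it stops activates a new non-seed node. -/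
def numSteps (T : Finset V) : Termination → ℕ
  | .steps K => K
  | .complete => #(univ \ T)

/-- The value `U(S)`: expected number of nodes of `V \ T` activated by `S` in `G_{T,S}`. -/
def value (G : Network V) (T : Finset V) (τ : Termination) (S : Finset V) : ℝ :=
  ∑ s : Finset V × Finset V,
    ((G.restrictSeeds T S).icState S (numSteps T τ) s).toReal * (#(s.1 \ T) : ℝ)

/-- Seeds that come before `t` in the ordering `π` of the seeds. -/
def before {T : Finset V} (π : T ≃ Fin #T) (t : T) : Finset V :=
  (univ.filter fun s : T => π s < π t).image Subtype.val

/-- The Shapley value of the seed `t`: its average marginal contribution over all orderings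
of `T`. -/
def shap (G : Network V) (T : Finset V) (τ : Termination) (t : T) : ℝ :=
  (1 / (Nat.factorial #T : ℝ)) * ∑ π : T ≃ Fin #T,
    (G.value T τ (insert t.1 (before π t)) - G.value T τ (before π t))

/-- The `k`-th largest value of `f`, with multiplicity, for `1 ≤ k ≤ |ι|`: the largest value of `f`
that is attained or exceeded at `k` or more indices. -/
def kthLargest {ι : Type*} [Fintype ι] (k : ℕ) (f : ι → ℝ) : ℝ :=
  sSup {x | x ∈ Set.range f ∧ k ≤ #(univ.filter fun t => x ≤ f t)}

/-! ### Random reverse-reachable sets -/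

/-- `u` reaches `v` in the graph `g` by a walk of at most `K` edges. -/
def reachWithin (g : Finset (V × V)) : ℕ → V → V → Prop
  | 0, u, v => u = v
  | K + 1, u, v => reachWithin g K u v ∨ ∃ w, (u, w) ∈ g ∧ reachWithin g K w v

/-- `u` reaches `v` in `g`, within `K` edges if the diffusion is stopped after `K` steps. -/
def reaches (g : Finset (V × V)) : Termination → V → V → Prop
  | .steps K, u, v => reachWithin g K u v
  | .complete, u, v => Relation.ReflTransGen (fun a b => (a, b) ∈ g) u v

open Classical in
/-- The reverse-reachable set of `v` in `g`. -/
def rrSet (g : Finset (V × V)) (τ : Termination) (v : V) : Finset V :=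
  univ.filter fun u => reaches g τ u v

/-- A random RR set in `H`: a uniformly random root in `V \ T` and its reverse-reachable set in a
random live-edge graph of `H`. (If every node is a seed there is no root, and the set is empty.) -/
def randomRRSet (H : Network V) (T : Finset V) (τ : Termination) : PMF (Finset V) :=
  if h : (univ \ T).Nonempty then
    (PMF.uniformOfFinset (univ \ T) h).bind fun v => H.liveEdges.map fun g => rrSet g τ v
  else PMF.pure ∅

/-! ### The algorithm -/

/-- The modified graph `G'`: all edges into seeds are removed. -/
def removeSeedIn (G : Network V) (T : Finset V) : Network V where
  edges := G.edges.filter fun e => e.2 ∉ T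
  prob := G.prob

/-- Update of the counters by one RR set `R`. -/
def addRR {T : Finset V} (est : T → ℝ) (R : Finset V) : T → ℝ := fun t =>
  if t.1 ∈ R ∩ T then est t + 1 / (#(R ∩ T) : ℝ) else est t

/-- Draw `m` new independent RR sets and update the counters by each of them. -/
def sampleRR (H : Network V) (T : Finset V) (τ : Termination) : ℕ → (T → ℝ) → PMF (T → ℝ)
  | 0, est => PMF.pure est
  | m + 1, est => (H.randomRRSet T τ).bind fun R => H.sampleRR T τ m (addRR est R)

/-- `x_i = n' / 2^i`, for `n'` non-seed nodes. -/
def xThr (n' i : ℕ) : ℝ := n' / 2 ^ i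

/-- The sample sizes `θ_i` of the first phase (`m = |T|`, `ε' = √2 ε`), with `θ_0 = 0`. -/
def thetaPhase1 (n' m : ℕ) (ε' l : ℝ) (i : ℕ) : ℕ :=
  if i = 0 then 0 else
    ⌈(n' * (2 + 2 / 3 * ε')) / (ε' ^ 2 * xThr n' i) *
      (l * Real.log n' + Real.log m + Real.log (Real.logb 2 n') + Real.log 2)⌉₊

/-- The sample size `θ` of the second phase. -/
def thetaPhase2 (n' m : ℕ) (ε l LB : ℝ) : ℕ :=
  ⌈(n' * (2 + 2 / 3 * ε)) / (ε ^ 2 * LB) * (l * Real.log n' + Real.log m + Real.log 4)⌉₊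

/-- The for-loop of `EstimateThreshold` from round `i` on, with the given number of rounds left
and the current counters `est`. -/
def thresholdLoop (H : Network V) (T : Finset V) (τ : Termination) (ε' l : ℝ) (k : ℕ) :
    ℕ → ℕ → (T → ℝ) → PMF ℝ
  | 0, _, _ => PMF.pure 1
  | r + 1, i, est =>
    let n' := #(univ \ T)
    let θ := thetaPhase1 n' #T ε' l
    (H.sampleRR T τ (θ i - θ (i - 1)) est).bind fun est' =>
      if (1 + ε') * xThr n' i ≤ n' * (kthLargest k est' / θ i) then
        PMF.pure (n' * (kthLargest k est' / (θ i * (1 + ε'))))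
      else H.thresholdLoop T τ ε' l k r (i + 1) est'

/-- `EstimateThreshold`: the loop over `i = 1, …, ⌊log₂ n'⌋ - 1`, from zero counters. -/
def estimateThreshold (H : Network V) (T : Finset V) (τ : Termination) (ε l : ℝ) (k : ℕ) :
    PMF ℝ :=
  H.thresholdLoop T τ (Real.sqrt 2 * ε) l k (Nat.log 2 #(univ \ T) - 1) 1 0

/-- `ApproxRRset`: the law of the returned vector of estimated Shapley values. -/
def approxRRset (G : Network V) (T : Finset V) (τ : Termination) (ε l : ℝ) (k : ℕ) :
    PMF (T → ℝ) :=
  let G' := G.removeSeedIn T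
  let n' := #(univ \ T)
  (G'.estimateThreshold T τ ε l k).bind fun LB =>
    let θ := thetaPhase2 n' #T ε l LB
    (G'.sampleRR T τ θ 0).map fun est t => n' * (est t / θ)

end Network

end

/-! ### From the cascade to reverse reachability. -/

noncomputable section

namespace Network

section Reachability

variable {V : Type*}

/-! Exact identity. No edge is attempted twice, so the fresh coins of all steps can be replaced by
one live-edge graph (`icRun_eq_map`). A walk from `S` avoiding `T \ S` can be cut at its last seed,
so `v ∉ T` is activated by `S` iff its RR set in `G'` meets `S` (`mem_detStep_iterate_iff`). Hence
`U(S)` is `n'` times the probability that a random RR set `R` meets `S`. For fixed `R`, a seed `t ∈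
R` has a marginal contribution only when it is first in `R ∩ T`, that is, in a fraction `1/|R ∩ T|`
of the orderings. So `Shap(t)` is `n'` times the mean counter increment (`shap_eq_mul_pmfMean`).

Concentration. Increments lie in `[0, 1]`. The Chernoff bounds `sampleRR_upper_tail_le` and
`sampleRR_lower_tail_le` measure the deviation by any `ν` not below the mean, so a seed of small
value can be judged on the scale of `Shap^(k)`.

Sample size. Extra samples do no harm, so Phase 1 need only ensure `0 < LB ≤ Shap^(k)`. Union bounds
over seeds and rounds give it failure probability at most `1/(2 n'^l)`
(`estimateThreshold_fail_le`). For such an `LB`, Phase 2 fails with probability at most `1/(2 n'^l)`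
(`phase2_fail_le`). -/

theorem reachWithin_succ_tail (g : Finset (V × V)) (K : ℕ) (u v : V) :
    reachWithin g (K + 1) u v ↔
      reachWithin g K u v ∨ ∃ w, reachWithin g K u w ∧ (w, v) ∈ g := by
  induction K generalizing u with
  | zero => simp [reachWithin]
  | succ K ih =>
    constructor
    · rintro (h | ⟨w, hw, h⟩)
      · exact Or.inl h
      · rcases (ih w).1 h with h | ⟨x, hx, hxv⟩
        · exact Or.inl (Or.inr ⟨w, hw, h⟩)
        · exact Or.inr ⟨x, Or.inr ⟨w, hw, hx⟩, hxv⟩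
    · rintro (h | ⟨x, hx | ⟨w, hw, hx⟩, hxv⟩)
      · exact Or.inl h
      · exact Or.inl ((ih u).2 (Or.inr ⟨x, hx, hxv⟩))
      · exact Or.inr ⟨w, hw, (ih w).2 (Or.inr ⟨x, hx, hxv⟩)⟩

theorem reflTransGen_of_reachWithin {g : Finset (V × V)} {K : ℕ} {u v : V}
    (h : reachWithin g K u v) : Relation.ReflTransGen (fun a b => (a, b) ∈ g) u v := by
  induction K generalizing u with
  | zero => exact h ▸ Relation.ReflTransGen.refl
  | succ K ih =>
    rcases h with h | ⟨w, hw, h⟩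
    · exact ih h
    · exact Relation.ReflTransGen.head hw (ih h)

end Reachability

variable {V : Type*} [DecidableEq V]

/-! ### Live-edge graphs -/

/-- The expectation of `F` over the live-edge graph with edge set `E` and probabilities `p`. -/
def liveSum (p : V × V → unitInterval) (E : Finset (V × V)) (F : Finset (V × V) → ENNReal) :
    ENNReal :=
  ∑ g ∈ E.powerset, (Network.mk E p).liveWeight g * F g

theorem liveSum_empty (p : V × V → unitInterval) (F : Finset (V × V) → ENNReal) :
    liveSum p ∅ F = F ∅ := by
  simp [liveSum, liveWeight]

theorem liveSum_add (p : V × V → unitInterval) (E : Finset (V × V))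
    (F F' : Finset (V × V) → ENNReal) :
    liveSum p E (fun g => F g + F' g) = liveSum p E F + liveSum p E F' := by
  simp [liveSum, mul_add, Finset.sum_add_distrib]

theorem liveSum_const_mul (p : V × V → unitInterval) (E : Finset (V × V)) (c : ENNReal)
    (F : Finset (V × V) → ENNReal) :
    liveSum p E (fun g => c * F g) = c * liveSum p E F := by
  simp only [liveSum, Finset.mul_sum]
  exact Finset.sum_congr rfl fun g _ => by ring

theorem ofReal_prob_add (x : unitInterval) :
    ENNReal.ofReal (1 - x) + ENNReal.ofReal x = 1 := by
  rw [← ENNReal.ofReal_add (sub_nonneg.2 x.2.2) x.2.1]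
  simp

theorem liveSum_insert (p : V × V → unitInterval) {E : Finset (V × V)} {e : V × V} (he : e ∉ E)
    (F : Finset (V × V) → ENNReal) :
    liveSum p (insert e E) F = ENNReal.ofReal (1 - p e) * liveSum p E F +
      ENNReal.ofReal (p e) * liveSum p E fun g => F (insert e g) := by
  rw [liveSum, Finset.sum_powerset_insert he, liveSum, liveSum, Finset.mul_sum, Finset.mul_sum]
  congr 1
  · refine Finset.sum_congr rfl fun g hg => ?_
    have heg : e ∉ g := fun h => he (mem_powerset.1 hg h)
    simp only [liveWeight]
    rw [insert_sdiff_of_notMem _ heg, Finset.prod_insert (fun h => he (mem_sdiff.1 h).1)]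
    ring
  · refine Finset.sum_congr rfl fun g hg => ?_
    have heg : e ∉ g := fun h => he (mem_powerset.1 hg h)
    simp only [liveWeight]
    rw [Finset.prod_insert heg, insert_sdiff_insert, sdiff_insert_of_notMem he]
    ring

theorem liveSum_inter (p : V × V → unitInterval) (E D : Finset (V × V))
    (F : Finset (V × V) → ENNReal) :
    liveSum p E (fun g => F (g ∩ D)) = liveSum p (E ∩ D) F := by
  induction E using Finset.induction_on generalizing F with
  | empty => simp [liveSum_empty]
  | insert e E he ih =>
    rw [liveSum_insert p he, ih]
    by_cases hD : e ∈ D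
    · rw [insert_inter_of_mem hD, liveSum_insert p (fun h => he (mem_inter.1 h).1)]
      simp only [insert_inter_of_mem hD]
      rw [ih fun g => F (insert e g)]
    · rw [insert_inter_of_notMem hD]
      simp only [insert_inter_of_notMem hD]
      rw [ih, ← add_mul, ofReal_prob_add, one_mul]

/-- Drawing the edges outside `B` afresh does not change the law of the live-edge graph. -/
theorem liveSum_resample (p : V × V → unitInterval) (E : Finset (V × V)) (B : V × V → Prop)
    [DecidablePred B] (F : Finset (V × V) → ENNReal) :
    liveSum p E (fun g => liveSum p E fun g' => F (g.filter B ∪ g'.filter fun e => ¬ B e)) =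
      liveSum p E F := by
  induction E using Finset.induction_on generalizing F with
  | empty => simp [liveSum_empty]
  | insert e E he ih =>
    simp only [liveSum_insert p he, liveSum_add, liveSum_const_mul]
    -- Only one of the two copies of `e` is read; the weights of the other add up to `1`.
    by_cases hB : B e
    · simp only [Finset.filter_insert, hB, not_true_eq_false, if_true, if_false, insert_union]
      rw [ih, ih fun g => F (insert e g), ← add_mul, ofReal_prob_add, one_mul, ← add_mul,
        ofReal_prob_add, one_mul]
    · simp only [Finset.filter_insert, hB, not_false_eq_true, if_true, if_false, union_insert]
      rw [ih, ih fun g => F (insert e g), ← add_mul, ofReal_prob_add, one_mul]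

theorem liveEdges_bind_apply (G : Network V) {β : Type*} (f : Finset (V × V) → PMF β) (b : β) :
    (G.liveEdges.bind f) b = liveSum G.prob G.edges fun g => f g b := by
  rw [PMF.bind_apply, tsum_eq_sum (s := G.edges.powerset)]
  · refine Finset.sum_congr rfl fun g hg => ?_
    rw [liveEdges, PMF.ofFinset_apply, if_pos hg]
  · intro g hg
    rw [liveEdges, PMF.ofFinset_apply, if_neg hg, zero_mul]

theorem liveEdges_bind_liveEdges_bind (G : Network V) {β : Type*} (B : V × V → Prop)
    [DecidablePred B] (f : Finset (V × V) → PMF β) :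
    (G.liveEdges.bind fun g => G.liveEdges.bind fun g' =>
      f (g.filter B ∪ g'.filter fun e => ¬ B e)) = G.liveEdges.bind f := by
  ext b
  simp only [liveEdges_bind_apply]
  exact liveSum_resample G.prob G.edges B fun g => f g b

/-- Couples all the graphs `G_{T,S}` and `G'` through one live-edge graph of `G`, so that they can
be compared outcome by outcome. -/
theorem liveEdges_eq_map_inter (G H : Network V) (hE : H.edges ⊆ G.edges)
    (hp : H.prob = G.prob) : H.liveEdges = G.liveEdges.map (· ∩ H.edges) := by
  rw [← PMF.bind_pure H.liveEdges, ← PMF.bind_pure_comp]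
  ext b
  simp only [liveEdges_bind_apply, Function.comp_apply, hp]
  rw [liveSum_inter G.prob G.edges H.edges fun g => (PMF.pure g) b, inter_eq_right.2 hE]

/-! ### Seeds and reachability -/

/-- Cut the walk at its last entry into a seed: that seed lies in `S`, as no edge touches `T \ S`,
and no later edge enters `T`. -/
theorem reachWithin_removeSeedIn_of_restrictSeeds (G : Network V) {T S : Finset V}
    (g : Finset (V × V)) {v : V} (K : ℕ) (u : V)
    (h : reachWithin (g ∩ (G.restrictSeeds T S).edges) K u v) :
    (∃ s ∈ S, reachWithin (g ∩ (G.removeSeedIn T).edges) K s v) ∨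
      reachWithin (g ∩ (G.removeSeedIn T).edges) K u v := by
  induction K generalizing u with
  | zero => exact Or.inr h
  | succ K ih =>
    rcases h with h | ⟨w, hw, h⟩
    · rcases ih u h with ⟨s, hs, h⟩ | h
      · exact Or.inl ⟨s, hs, Or.inl h⟩
      · exact Or.inr (Or.inl h)
    · rcases ih w h with ⟨s, hs, h⟩ | h
      · exact Or.inl ⟨s, hs, Or.inl h⟩
      · simp only [restrictSeeds, mem_inter, mem_filter, mem_sdiff, not_and, not_not] at hw
        by_cases hwT : w ∈ T
        · exact Or.inl ⟨w, hw.2.2.2 hwT, Or.inl h⟩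
        · refine Or.inr (Or.inr ⟨w, ?_, h⟩)
          simp [removeSeedIn, hw.1, hw.2.1, hwT]

/-- After its first node a walk in `G'` meets no seed, so only the start could lie in `T \ S`. -/
theorem reachWithin_restrictSeeds_of_removeSeedIn (G : Network V) {T S : Finset V}
    (g : Finset (V × V)) {v : V} (K : ℕ) (u : V) (hu : u ∉ T \ S)
    (h : reachWithin (g ∩ (G.removeSeedIn T).edges) K u v) :
    reachWithin (g ∩ (G.restrictSeeds T S).edges) K u v := by
  induction K generalizing u with
  | zero => exact h
  | succ K ih =>
    rcases h with h | ⟨w, hw, h⟩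
    · exact Or.inl (ih u hu h)
    · simp only [removeSeedIn, mem_inter, mem_filter] at hw
      have hw' : w ∉ T \ S := fun h => hw.2.2 (mem_sdiff.1 h).1
      refine Or.inr ⟨w, ?_, ih w hw' h⟩
      simp only [restrictSeeds, mem_inter, mem_filter]
      exact ⟨hw.1, hw.2.1, hu, hw'⟩

/-! ### The cascade as reachability in one live-edge graph -/

variable [Fintype V]

/-- One step of the cascade when the outcomes of the attempts are given by `g`. -/
def detStep (g : Finset (V × V)) (s : Finset V × Finset V) : Finset V × Finset V :=
  (s.1 ∪ univ.filter fun v => v ∉ s.1 ∧ ∃ u ∈ s.2, (u, v) ∈ g,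
    univ.filter fun v => v ∉ s.1 ∧ ∃ u ∈ s.2, (u, v) ∈ g)

theorem icStep_eq_map_detStep (G : Network V) (s : Finset V × Finset V) :
    G.icStep s = G.liveEdges.map fun g => detStep g s := rfl

/-- The state after `K` steps of the cascade from the state `s`. -/
def icRun (G : Network V) : ℕ → Finset V × Finset V → PMF (Finset V × Finset V)
  | 0, s => PMF.pure s
  | K + 1, s => (G.icStep s).bind (G.icRun K)

theorem icRun_bind_icStep (G : Network V) (K : ℕ) (s : Finset V × Finset V) :
    (G.icRun K s).bind G.icStep = G.icRun (K + 1) s := by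
  induction K generalizing s with
  | zero => simp only [icRun, PMF.pure_bind]; exact (PMF.bind_pure _).symm
  | succ K ih =>
    rw [icRun, PMF.bind_bind]
    simp only [ih]
    rfl

/-- Peeling off the first step instead of the last allows an induction over arbitrary initial
states. -/
theorem icState_eq_icRun (G : Network V) (S : Finset V) (K : ℕ) :
    G.icState S K = G.icRun K (S, S) := by
  induction K with
  | zero => rfl
  | succ K ih => rw [icState, ih, icRun_bind_icStep]

theorem detStep_congr {g g' : Finset (V × V)} {s : Finset V × Finset V}
    (h : ∀ u ∈ s.2, ∀ v, (u, v) ∈ g ↔ (u, v) ∈ g') : detStep g s = detStep g' s := by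
  have : (univ.filter fun v => v ∉ s.1 ∧ ∃ u ∈ s.2, (u, v) ∈ g) =
      univ.filter fun v => v ∉ s.1 ∧ ∃ u ∈ s.2, (u, v) ∈ g' := by
    ext v
    simp only [mem_filter, mem_univ, true_and]
    exact and_congr_right fun _ => exists_congr fun u => and_congr_right fun hu => h u hu v
  rw [detStep, detStep, this]

/-- Nodes of `A` are active but not new, and never become new again, so edges leaving `A` are never
read. -/
theorem detStep_iterate_congr {g g' : Finset (V × V)} {A : Finset V}
    (h : ∀ u ∉ A, ∀ v, (u, v) ∈ g ↔ (u, v) ∈ g') (K : ℕ) :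
    ∀ s : Finset V × Finset V, A ⊆ s.1 → Disjoint A s.2 →
      (detStep g)^[K] s = (detStep g')^[K] s := by
  induction K with
  | zero => intros; rfl
  | succ K ih =>
    intro s h1 h2
    have hs : detStep g s = detStep g' s :=
      detStep_congr fun u hu => h u (Finset.disjoint_right.1 h2 hu)
    rw [Function.iterate_succ_apply, Function.iterate_succ_apply, ← hs]
    refine ih _ (h1.trans subset_union_left) ?_
    rw [Finset.disjoint_left]
    intro a ha ha'
    exact (mem_filter.1 ha').2.1 (h1 ha)

/-- Deferred decisions: the first step reads only edges leaving `s.1`, later steps only edges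
leaving its complement, so two independent draws splice into one. -/
theorem icRun_eq_map (G : Network V) (K : ℕ) (s : Finset V × Finset V) (hs : s.2 ⊆ s.1) :
    G.icRun K s = G.liveEdges.map fun g => (detStep g)^[K] s := by
  induction K generalizing s with
  | zero => simp only [icRun, Function.iterate_zero, id]; exact (PMF.map_const _ _).symm
  | succ K ih =>
    rw [icRun, icStep_eq_map_detStep, PMF.bind_map, ← PMF.bind_pure_comp (fun g => _) G.liveEdges,
      ← liveEdges_bind_liveEdges_bind G (fun e => e.1 ∈ s.1)
        (PMF.pure ∘ fun g => (detStep g)^[K + 1] s)]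
    congr 1
    funext g
    have hsub : (detStep g s).2 ⊆ (detStep g s).1 := subset_union_right
    rw [Function.comp_apply, ih _ hsub, ← PMF.bind_pure_comp]
    congr 1
    funext g'
    simp only [Function.comp_apply, Function.iterate_succ_apply]
    congr 1
    rw [detStep_congr (g := g.filter _ ∪ _) (g' := g) (s := s)
      (fun u hu v => by simp [hs hu])]
    refine detStep_iterate_congr (A := s.1) (fun u hu v => by simp [hu]) K _ subset_union_left ?_
    rw [Finset.disjoint_left]
    intro a ha ha'
    exact (mem_filter.1 ha').2.1 ha

/-- Older nodes have had their attempts, so only new ones matter next: the cascade is breadth-first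
search. -/
theorem detStep_iterate_invariant (g : Finset (V × V)) (S : Finset V) (K : ℕ) :
    (∀ u ∈ ((detStep g)^[K] (S, S)).1, u ∉ ((detStep g)^[K] (S, S)).2 →
      ∀ v, (u, v) ∈ g → v ∈ ((detStep g)^[K] (S, S)).1) ∧
    ((detStep g)^[K] (S, S)).2 ⊆ ((detStep g)^[K] (S, S)).1 := by
  induction K with
  | zero => exact ⟨fun u hu hu' => absurd hu hu', Subset.rfl⟩
  | succ K ih =>
    rw [Function.iterate_succ_apply']
    generalize (detStep g)^[K] (S, S) = s at ih
    refine ⟨fun u hu hu' v huv => ?_, subset_union_right⟩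
    have hu1 : u ∈ s.1 := (mem_union.1 hu).resolve_right hu'
    by_cases hv : v ∈ s.1
    · exact mem_union_left _ hv
    · by_cases hu2 : u ∈ s.2
      · exact mem_union_right _ (mem_filter.2 ⟨mem_univ _, hv, u, hu2, huv⟩)
      · exact absurd (ih.1 u hu1 hu2 v huv) hv

theorem mem_detStep_iterate (g : Finset (V × V)) (S : Finset V) (K : ℕ) (v : V) :
    v ∈ ((detStep g)^[K] (S, S)).1 ↔ ∃ s ∈ S, reachWithin g K s v := by
  induction K generalizing v with
  | zero => simp [reachWithin]
  | succ K ih =>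
    have hinv := detStep_iterate_invariant g S K
    simp only [reachWithin_succ_tail, and_or_left, exists_or]
    rw [← ih, Function.iterate_succ_apply']
    have : (∃ s ∈ S, ∃ w, reachWithin g K s w ∧ (w, v) ∈ g) ↔
        ∃ w ∈ ((detStep g)^[K] (S, S)).1, (w, v) ∈ g := by
      constructor
      · rintro ⟨s, hs, w, hw, h⟩; exact ⟨w, (ih w).2 ⟨s, hs, hw⟩, h⟩
      · rintro ⟨w, hw, h⟩
        obtain ⟨s, hs, hw⟩ := (ih w).1 hw
        exact ⟨s, hs, w, hw, h⟩
    rw [this]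
    generalize (detStep g)^[K] (S, S) = s at hinv
    constructor
    · intro h
      rcases mem_union.1 h with h | h
      · exact Or.inl h
      · obtain ⟨-, -, u, hu, huv⟩ := mem_filter.1 h
        exact Or.inr ⟨u, hinv.2 hu, huv⟩
    · rintro (h | ⟨w, hw, hwv⟩)
      · exact mem_union_left _ h
      · by_cases hv : v ∈ s.1
        · exact mem_union_left _ hv
        · by_cases hw2 : w ∈ s.2
          · exact mem_union_right _ (mem_filter.2 ⟨mem_univ _, hv, w, hw2, hwv⟩)
          · exact absurd (hinv.1 w hw hw2 v hwv) hv

/-! ### Reverse-reachable sets detect activation -/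

open Classical in
-- Each further step either adds a non-seed or reachability has stabilised. Counting non-seeds
-- suffices: no edge enters a seed, so a seed can only start a walk and costs at most the one extra
-- edge from `K` to `K + 1`.
theorem reachWithin_closed_or_card_lt {g : Finset (V × V)} {T : Finset V}
    (hg : ∀ e ∈ g, e.2 ∉ T) {v : V} (hv : v ∉ T) (K : ℕ) :
    (∀ u, Relation.ReflTransGen (fun a b => (a, b) ∈ g) u v → reachWithin g K u v) ∨
      K < #(univ.filter fun u => u ∉ T ∧ reachWithin g K u v) := by
  induction K with
  | zero =>
    refine Or.inr (Finset.card_pos.2 ⟨v, ?_⟩)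
    exact mem_filter.2 ⟨mem_univ v, hv, rfl⟩
  | succ K ih =>
    rcases ih with h | h
    · exact Or.inl fun u hu => Or.inl (h u hu)
    · by_cases hex : ∃ u, u ∉ T ∧ reachWithin g (K + 1) u v ∧ ¬ reachWithin g K u v
      · obtain ⟨u, huT, hu, hu'⟩ := hex
        refine Or.inr (lt_of_le_of_lt h (Finset.card_lt_card ?_))
        rw [Finset.ssubset_iff_of_subset]
        · exact ⟨u, by simp [huT, hu], by simp [hu']⟩
        · intro x hx
          simp only [mem_filter, mem_univ, true_and] at hx ⊢
          exact ⟨hx.1, Or.inl hx.2⟩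
      · push Not at hex
        left
        intro u hu
        induction hu using Relation.ReflTransGen.head_induction_on with
        | refl => exact Or.inl (hex v hv (by
            clear h hex
            induction K with
            | zero => exact Or.inl rfl
            | succ K ih => exact Or.inl ih))
        | head huw _ ihw => exact Or.inr ⟨_, huw, hex _ (hg _ huw) ihw⟩

theorem reachWithin_numSteps_iff_reaches {g : Finset (V × V)} {T : Finset V}
    (hg : ∀ e ∈ g, e.2 ∉ T) {v : V} (hv : v ∉ T) (τ : Termination) (u : V) :
    reachWithin g (numSteps T τ) u v ↔ reaches g τ u v := by
  classical
  cases τ with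
  | steps K => rfl
  | complete =>
    refine ⟨reflTransGen_of_reachWithin, fun h => ?_⟩
    rcases reachWithin_closed_or_card_lt hg hv #(univ \ T) with h' | h'
    · exact h' u h
    · refine absurd (Finset.card_le_card ?_) (not_le_of_gt h')
      intro x hx
      simpa using (mem_filter.1 hx).2.1

theorem mem_detStep_iterate_iff (G : Network V) {T S : Finset V} (τ : Termination)
    (g : Finset (V × V)) {v : V} (hv : v ∉ T) :
    v ∈ ((detStep (g ∩ (G.restrictSeeds T S).edges))^[numSteps T τ] (S, S)).1 ↔
      ∃ s ∈ S, s ∈ rrSet (g ∩ (G.removeSeedIn T).edges) τ v := by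
  rw [mem_detStep_iterate]
  have hg : ∀ e ∈ g ∩ (G.removeSeedIn T).edges, e.2 ∉ T := by
    intro e he
    simp only [removeSeedIn, mem_inter, mem_filter] at he
    exact he.2.2
  simp only [rrSet, mem_filter, mem_univ, true_and, ← reachWithin_numSteps_iff_reaches hg hv]
  constructor
  · rintro ⟨s, hs, h⟩
    rcases reachWithin_removeSeedIn_of_restrictSeeds G g _ s h with h | h
    · exact h
    · exact ⟨s, hs, h⟩
  · rintro ⟨s, hs, h⟩
    exact ⟨s, hs, reachWithin_restrictSeeds_of_removeSeedIn G g _ s (by simp [hs]) h⟩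

end Network

end

/-! ### Shapley values as means over random RR sets. -/

noncomputable section

namespace Network

/-! ### Expectations over finite types -/

/-- The expectation of `F` under `p`. -/
def pmfMean {α : Type*} [Fintype α] (p : PMF α) (F : α → ℝ) : ℝ := ∑ a, (p a).toReal * F a

theorem pmfMean_bind {α β : Type*} [Fintype α] [Fintype β] (p : PMF α) (f : α → PMF β)
    (F : β → ℝ) : pmfMean (p.bind f) F = pmfMean p fun a => pmfMean (f a) F := by
  simp only [pmfMean, PMF.bind_apply, tsum_fintype]
  rw [Finset.sum_congr rfl fun b _ => by
    rw [ENNReal.toReal_sum fun a _ => ENNReal.mul_ne_top (p.apply_ne_top a) ((f a).apply_ne_top b),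
      Finset.sum_mul], Finset.sum_comm]
  refine Finset.sum_congr rfl fun a _ => ?_
  rw [Finset.mul_sum]
  exact Finset.sum_congr rfl fun b _ => by rw [ENNReal.toReal_mul]; ring

theorem pmfMean_pure {α : Type*} [Fintype α] (a : α) (F : α → ℝ) :
    pmfMean (PMF.pure a) F = F a := by
  classical
  rw [pmfMean, Finset.sum_eq_single a]
  · simp
  · intro b _ hb; simp [PMF.pure_apply, hb]
  · simp

theorem pmfMean_map {α β : Type*} [Fintype α] [Fintype β] (p : PMF α) (f : α → β)
    (F : β → ℝ) : pmfMean (p.map f) F = pmfMean p fun a => F (f a) := by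
  rw [← PMF.bind_pure_comp, pmfMean_bind]
  simp only [Function.comp_apply, pmfMean_pure]

theorem pmfMean_const_mul {α : Type*} [Fintype α] (p : PMF α) (c : ℝ) (F : α → ℝ) :
    pmfMean p (fun a => c * F a) = c * pmfMean p F := by
  rw [pmfMean, pmfMean, Finset.mul_sum]
  exact Finset.sum_congr rfl fun a _ => by ring

theorem pmfMean_sub {α : Type*} [Fintype α] (p : PMF α) (F F' : α → ℝ) :
    pmfMean p (fun a => F a - F' a) = pmfMean p F - pmfMean p F' := by
  simp [pmfMean, mul_sub, Finset.sum_sub_distrib]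

theorem pmfMean_sum {α ι : Type*} [Fintype α] (p : PMF α) (s : Finset ι) (F : ι → α → ℝ) :
    pmfMean p (fun a => ∑ i ∈ s, F i a) = ∑ i ∈ s, pmfMean p (F i) := by
  simp only [pmfMean, Finset.mul_sum]
  exact Finset.sum_comm

theorem pmfMean_nonneg {α : Type*} [Fintype α] (p : PMF α) {F : α → ℝ} (hF : ∀ a, 0 ≤ F a) :
    0 ≤ pmfMean p F :=
  Finset.sum_nonneg fun a _ => mul_nonneg ENNReal.toReal_nonneg (hF a)

theorem pmfMean_uniformOfFinset {α : Type*} [Fintype α] {s : Finset α} (hs : s.Nonempty)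
    (F : α → ℝ) : pmfMean (PMF.uniformOfFinset s hs) F = (#s : ℝ)⁻¹ * ∑ a ∈ s, F a := by
  classical
  rw [pmfMean, Finset.mul_sum, ← Finset.sum_subset (Finset.subset_univ s)]
  · exact Finset.sum_congr rfl fun a ha => by simp [PMF.uniformOfFinset_apply, ha]
  · intro a _ ha; simp [PMF.uniformOfFinset_apply, ha]

/-! ### Orderings in which a given element comes first -/

/-- Swapping two elements of `A` shows that all are first equally often, and each ordering has
exactly one first element of `A`. -/
theorem card_equiv_first_mul_card {ι : Type*} [Fintype ι] [DecidableEq ι] {n : ℕ}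
    (hn : Fintype.card ι = n) {A : Finset ι} {t : ι} (ht : t ∈ A) :
    #(univ.filter fun π : ι ≃ Fin n => ∀ s ∈ A, π t ≤ π s) * #A = n.factorial := by
  have hsymm : ∀ t' ∈ A, #(univ.filter fun π : ι ≃ Fin n => ∀ s ∈ A, π t' ≤ π s) =
      #(univ.filter fun π : ι ≃ Fin n => ∀ s ∈ A, π t ≤ π s) := by
    intro t' ht'
    have hmem : ∀ s ∈ A, Equiv.swap t t' s ∈ A := by
      intro s hs
      by_cases h1 : s = t
      · rw [h1, Equiv.swap_apply_left]; exact ht'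
      · by_cases h2 : s = t'
        · rw [h2, Equiv.swap_apply_right]; exact ht
        · rwa [Equiv.swap_apply_of_ne_of_ne h1 h2]
    refine Finset.card_bij' (fun π _ => (Equiv.swap t t').trans π)
      (fun π _ => (Equiv.swap t t').trans π) ?_ ?_ ?_ ?_
    · intro π hπ
      simp only [mem_filter, mem_univ, true_and, Equiv.trans_apply, Equiv.swap_apply_left] at hπ ⊢
      exact fun s hs => hπ _ (hmem s hs)
    · intro π hπ
      simp only [mem_filter, mem_univ, true_and, Equiv.trans_apply, Equiv.swap_apply_right] at hπ ⊢
      exact fun s hs => hπ _ (hmem s hs)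
    · intro π _; ext; simp
    · intro π _; ext; simp
  have h1 : ∑ t' ∈ A, #(univ.filter fun π : ι ≃ Fin n => ∀ s ∈ A, π t' ≤ π s) =
      ∑ π : ι ≃ Fin n, #(A.filter fun t' => ∀ s ∈ A, π t' ≤ π s) := by
    simp only [Finset.card_filter]
    exact Finset.sum_comm
  have h2 : ∀ π : ι ≃ Fin n, #(A.filter fun t' => ∀ s ∈ A, π t' ≤ π s) = 1 := by
    intro π
    obtain ⟨m, hm, hmin⟩ := Finset.exists_min_image A π ⟨t, ht⟩
    refine Finset.card_eq_one.2 ⟨m, ?_⟩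
    ext x
    simp only [mem_filter, mem_singleton]
    constructor
    · rintro ⟨hx, h⟩
      exact π.injective (le_antisymm (h m hm) (hmin x hx))
    · rintro rfl
      exact ⟨hm, hmin⟩
  rw [Finset.sum_congr rfl hsymm, Finset.sum_const, smul_eq_mul,
    Finset.sum_congr rfl fun π _ => h2 π] at h1
  rw [mul_comm, h1, Finset.sum_const, smul_eq_mul, mul_one, Finset.card_univ,
    Fintype.card_equiv (Fintype.equivFinOfCardEq hn), hn]

variable {V : Type*} [DecidableEq V]

/-- The increment of the counter of `t` caused by the RR set `R`. -/
def increment {T : Finset V} (t : T) (R : Finset V) : ℝ :=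
  if t.1 ∈ R ∩ T then 1 / (#(R ∩ T) : ℝ) else 0

theorem increment_nonneg {T : Finset V} (t : T) (R : Finset V) : 0 ≤ increment t R := by
  unfold increment; split_ifs <;> positivity

theorem increment_le_one {T : Finset V} (t : T) (R : Finset V) : increment t R ≤ 1 := by
  unfold increment
  split_ifs with h
  · have : (1 : ℝ) ≤ #(R ∩ T) := by exact_mod_cast Finset.card_pos.2 ⟨_, h⟩
    exact div_le_one_of_le₀ this (by linarith)
  · exact zero_le_one

/-- The marginal is `1` when `t ∈ R` and `t` precedes all other seeds of `R`, and `0` otherwise. -/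
theorem sum_marginal_eq_increment {T : Finset V} (t : T) (R : Finset V) :
    (1 / (Nat.factorial #T : ℝ)) * ∑ π : T ≃ Fin #T,
      ((if ∃ s ∈ insert t.1 (before π t), s ∈ R then (1 : ℝ) else 0) -
        if ∃ s ∈ before π t, s ∈ R then 1 else 0) = increment t R := by
  classical
  set A : Finset T := univ.filter fun s => s.1 ∈ R with hA
  have hb : ∀ π : T ≃ Fin #T, (∃ s ∈ before π t, s ∈ R) ↔ ¬ ∀ s ∈ A, π t ≤ π s := by
    intro π
    simp only [before, mem_image, mem_filter, mem_univ, true_and, hA]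
    push Not
    constructor
    · rintro ⟨_, ⟨s, hs, rfl⟩, hR⟩; exact ⟨s, hR, hs⟩
    · rintro ⟨s, hR, hs⟩; exact ⟨s, ⟨s, hs, rfl⟩, hR⟩
  have hmarg : ∀ π : T ≃ Fin #T,
      ((if ∃ s ∈ insert t.1 (before π t), s ∈ R then (1 : ℝ) else 0) -
        if ∃ s ∈ before π t, s ∈ R then 1 else 0) =
      if t.1 ∈ R then (if ∀ s ∈ A, π t ≤ π s then 1 else 0) else 0 := by
    intro π
    simp only [Finset.exists_mem_insert, hb]
    by_cases h1 : t.1 ∈ R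
    · by_cases h2 : ∀ s ∈ A, π t ≤ π s
      · rw [if_pos (Or.inl h1), if_neg (not_not.2 h2), if_pos h1, if_pos h2, sub_zero]
      · rw [if_pos (Or.inl h1), if_pos h2, if_pos h1, if_neg h2, sub_self]
    · simp [h1]
  rw [Finset.sum_congr rfl fun π _ => hmarg π, increment]
  have hcard : #(R ∩ T) = #A := by
    rw [← Finset.card_map (Function.Embedding.subtype _) (s := A)]
    congr 1
    ext x
    simp [hA, and_comm]
  by_cases h : t.1 ∈ R
  · have hcount := card_equiv_first_mul_card (Fintype.card_coe T) (A := A) (t := t) (by simp [hA, h])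
    simp only [h, if_true, mem_inter, t.2, and_self, hcard, Finset.sum_boole]
    rw [← hcount]
    have h0 : (#T).factorial ≠ 0 := Nat.factorial_ne_zero _
    rw [← hcount] at h0
    have h3 := left_ne_zero_of_mul h0
    have h4 := right_ne_zero_of_mul h0
    push_cast
    field_simp
  · simp [h]

variable [Fintype V]

/-! ### Values and Shapley values as expectations over random RR sets -/

theorem pmfMean_randomRRSet (G : Network V) {T : Finset V} (hT : (univ \ T).Nonempty)
    (τ : Termination) (F : Finset V → ℝ) :
    pmfMean ((G.removeSeedIn T).randomRRSet T τ) F = (#(univ \ T) : ℝ)⁻¹ *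
      ∑ v ∈ univ \ T, pmfMean G.liveEdges fun g => F (rrSet (g ∩ (G.removeSeedIn T).edges) τ v) := by
  rw [randomRRSet, dif_pos hT, pmfMean_bind, pmfMean_uniformOfFinset]
  congr 1
  refine Finset.sum_congr rfl fun v _ => ?_
  rw [liveEdges_eq_map_inter G (G.removeSeedIn T) (Finset.filter_subset _ _) rfl, PMF.map_comp,
    pmfMean_map]
  rfl

theorem value_eq_mul_pmfMean (G : Network V) (T : Finset V) (τ : Termination) (S : Finset V) :
    G.value T τ S = #(univ \ T) * pmfMean ((G.removeSeedIn T).randomRRSet T τ)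
      fun R => if ∃ s ∈ S, s ∈ R then 1 else 0 := by
  classical
  have h1 : G.value T τ S = pmfMean G.liveEdges fun g => ∑ v ∈ univ \ T,
      if ∃ s ∈ S, s ∈ rrSet (g ∩ (G.removeSeedIn T).edges) τ v then (1 : ℝ) else 0 := by
    change pmfMean ((G.restrictSeeds T S).icState S (numSteps T τ))
      (fun s => (#(s.1 \ T) : ℝ)) = _
    rw [icState_eq_icRun, icRun_eq_map _ _ _ Subset.rfl,
      liveEdges_eq_map_inter G (G.restrictSeeds T S) (Finset.filter_subset _ _) rfl, PMF.map_comp,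
      pmfMean_map]
    congr 1
    funext g
    rw [Finset.sum_boole]
    congr 2
    ext v
    simp only [mem_sdiff, mem_filter, mem_univ, true_and, Function.comp_apply]
    rw [and_comm]
    exact and_congr_right fun hv => mem_detStep_iterate_iff G τ g hv
  rw [h1, pmfMean_sum]
  rcases (univ \ T).eq_empty_or_nonempty with hT | hT
  · simp [hT]
  · have : (#(univ \ T) : ℝ) ≠ 0 := by exact_mod_cast (Finset.card_pos.2 hT).ne'
    rw [pmfMean_randomRRSet G hT, ← mul_assoc, mul_inv_cancel₀ this, one_mul]

/-- The Shapley value of `t` is `n'` times the mean counter increment. -/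
theorem shap_eq_mul_pmfMean (G : Network V) (T : Finset V) (τ : Termination) (t : T) :
    G.shap T τ t = #(univ \ T) *
      pmfMean ((G.removeSeedIn T).randomRRSet T τ) (increment t) := by
  have : (increment t : Finset V → ℝ) = fun R => _ :=
    funext fun R => (sum_marginal_eq_increment t R).symm
  rw [this, pmfMean_const_mul, pmfMean_sum, shap]
  simp only [pmfMean_sub, value_eq_mul_pmfMean, ← mul_sub, ← Finset.mul_sum]
  ring

end Network

end

/-! ### Exponential moments and tail bounds. -/

noncomputable section

/-! ### Elementary bounds on the exponential function -/

/-- From the quadratic term on, `(n + 2)! ≥ 2 * 3 ^ n` bounds the series by a geometric one. -/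
theorem Real.exp_le_one_add_add_sq_div {x : ℝ} (hx : 0 ≤ x) (hx3 : x < 3) :
    Real.exp x ≤ 1 + x + x ^ 2 / (2 * (1 - x / 3)) := by
  have hsum : HasSum (fun n : ℕ => x ^ n / (n.factorial : ℝ)) (Real.exp x) := by
    rw [Real.exp_eq_exp_ℝ]
    exact NormedSpace.expSeries_div_hasSum_exp x
  have htail := (hasSum_nat_add_iff' 2).2 hsum
  have hgeo : HasSum (fun n : ℕ => x ^ 2 / 2 * (x / 3) ^ n) (x ^ 2 / 2 * (1 - x / 3)⁻¹) :=
    (hasSum_geometric_of_lt_one (by positivity) (by linarith)).mul_left _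
  have hfac : ∀ n : ℕ, (2 : ℝ) * 3 ^ n ≤ ((n + 2).factorial : ℝ) := by
    intro n
    exact_mod_cast Nat.factorial_mul_pow_le_factorial (m := 2) (n := n) |>.trans
      (by rw [add_comm])
  have hle := hasSum_le (fun n => by
    calc x ^ (n + 2) / ((n + 2).factorial : ℝ) ≤ x ^ (n + 2) / (2 * 3 ^ n) :=
          div_le_div_of_nonneg_left (by positivity) (by positivity) (hfac n)
      _ = x ^ 2 / 2 * (x / 3) ^ n := by rw [pow_add, div_pow]; field_simp) htail hgeo
  simp only [Finset.sum_range_succ, Finset.sum_range_zero, Nat.factorial, pow_zero, pow_one] at hle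
  rw [← div_eq_mul_inv, div_div] at hle
  norm_num at hle
  linarith

/-- Follows from `exp x ≥ 1 + x + x²/2`, as `(1 + x + x²/2)(1 - x + x²/2) = 1 + x⁴/4 ≥ 1`. -/
theorem Real.exp_neg_le_one_sub_add_sq_div_two {x : ℝ} (hx : 0 ≤ x) :
    Real.exp (-x) ≤ 1 - x + x ^ 2 / 2 := by
  have h := Real.quadratic_le_exp_of_nonneg hx
  rw [Real.exp_neg]
  refine inv_le_of_inv_le₀ (by nlinarith [sq_nonneg (x - 1)]) (le_trans ?_ h)
  rw [inv_le_iff_one_le_mul₀ (by nlinarith [sq_nonneg (x - 1)])]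
  nlinarith [sq_nonneg (x ^ 2)]

theorem Real.exp_mul_le_one_add_mul {c x : ℝ} (hx : 0 ≤ x) (hx1 : x ≤ 1) :
    Real.exp (c * x) ≤ 1 + x * (Real.exp c - 1) := by
  have h := convexOn_exp.2 (Set.mem_univ c) (Set.mem_univ 0) hx (sub_nonneg.2 hx1) (by ring)
  simp only [smul_eq_mul, mul_zero, add_zero, Real.exp_zero] at h
  rw [mul_comm c x]
  linarith

namespace PMF

theorem tsum_bind_mul {α β : Type*} (p : PMF α) (f : α → PMF β) (F : β → ENNReal) :
    ∑' b, (p.bind f) b * F b = ∑' a, p a * ∑' b, f a b * F b := by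
  simp only [PMF.bind_apply, ← ENNReal.tsum_mul_right, ← ENNReal.tsum_mul_left, mul_assoc]
  exact ENNReal.tsum_comm

/-- Markov's inequality. -/
theorem toOuterMeasure_le_tsum {α : Type*} (p : PMF α) (s : Set α) (F : α → ENNReal)
    (hF : ∀ a ∈ s, 1 ≤ F a) : p.toOuterMeasure s ≤ ∑' a, p a * F a := by
  rw [PMF.toOuterMeasure_apply]
  refine ENNReal.tsum_le_tsum fun a => ?_
  by_cases ha : a ∈ s
  · rw [Set.indicator_of_mem ha]
    exact le_mul_of_one_le_right (zero_le) (hF a ha)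
  · rw [Set.indicator_of_notMem ha]; exact zero_le

end PMF

namespace Network

theorem pmfMean_one {α : Type*} [Fintype α] (p : PMF α) : pmfMean p (fun _ => 1) = 1 := by
  simp only [pmfMean, mul_one]
  rw [← ENNReal.toReal_sum fun a _ => p.apply_ne_top a, ← tsum_fintype (L := .unconditional α),
    p.tsum_coe, ENNReal.toReal_one]

theorem pmfMean_le {α : Type*} [Fintype α] (p : PMF α) {F F' : α → ℝ} (h : ∀ a, F a ≤ F' a) :
    pmfMean p F ≤ pmfMean p F' :=
  Finset.sum_le_sum fun a _ => mul_le_mul_of_nonneg_left (h a) ENNReal.toReal_nonneg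

theorem tsum_mul_ofReal {α : Type*} [Fintype α] (p : PMF α) {F : α → ℝ} (hF : ∀ a, 0 ≤ F a) :
    ∑' a, p a * ENNReal.ofReal (F a) = ENNReal.ofReal (pmfMean p F) := by
  rw [tsum_fintype, pmfMean, ENNReal.ofReal_sum_of_nonneg fun a _ =>
    mul_nonneg ENNReal.toReal_nonneg (hF a)]
  refine Finset.sum_congr rfl fun a _ => ?_
  rw [ENNReal.ofReal_mul ENNReal.toReal_nonneg, ENNReal.ofReal_toReal (p.apply_ne_top a)]

theorem pmfMean_exp_le {α : Type*} [Fintype α] (p : PMF α) {X : α → ℝ} (h0 : ∀ a, 0 ≤ X a)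
    (h1 : ∀ a, X a ≤ 1) (c : ℝ) :
    pmfMean p (fun a => Real.exp (c * X a)) ≤ Real.exp (pmfMean p X * (Real.exp c - 1)) := by
  refine (pmfMean_le p fun a => Real.exp_mul_le_one_add_mul (c := c) (h0 a) (h1 a)).trans ?_
  have : pmfMean p (fun a => 1 + X a * (Real.exp c - 1)) =
      1 + pmfMean p X * (Real.exp c - 1) := by
    have h := pmfMean_one p
    simp only [pmfMean] at h
    simp only [pmfMean, mul_add, Finset.sum_add_distrib, Finset.sum_mul, mul_assoc, h]
  rw [this, add_comm]
  exact Real.add_one_le_exp _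

variable {V : Type*} [DecidableEq V]

/-! ### Chernoff bounds for the counters -/

theorem addRR_apply {T : Finset V} (est : T → ℝ) (R : Finset V) (t : T) :
    addRR est R t = est t + increment t R := by
  unfold addRR increment
  split_ifs <;> simp

variable [Fintype V]

theorem sampleRR_add (H : Network V) (T : Finset V) (τ : Termination) (a b : ℕ) (est : T → ℝ) :
    H.sampleRR T τ (a + b) est = (H.sampleRR T τ a est).bind (H.sampleRR T τ b) := by
  induction a generalizing est with
  | zero => rw [Nat.zero_add, sampleRR, PMF.pure_bind]
  | succ a ih => simp only [Nat.succ_add, sampleRR, PMF.bind_bind, ih]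

theorem tsum_sampleRR_exp_le (H : Network V) (T : Finset V) (τ : Termination) (t : T) (c : ℝ)
    (m : ℕ) (est : T → ℝ) :
    ∑' x, H.sampleRR T τ m est x * ENNReal.ofReal (Real.exp (c * x t)) ≤
      ENNReal.ofReal (Real.exp (c * est t +
        m * (pmfMean (H.randomRRSet T τ) (increment t) * (Real.exp c - 1)))) := by
  induction m generalizing est with
  | zero =>
    rw [sampleRR, tsum_eq_single est]
    · simp
    · intro x hx; simp [PMF.pure_apply, hx]
  | succ m ih =>
    rw [sampleRR, PMF.tsum_bind_mul]
    refine (ENNReal.tsum_le_tsum fun R => mul_le_mul_right (ih (addRR est R)) _).trans ?_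
    rw [tsum_mul_ofReal _ fun R => (Real.exp_pos _).le]
    refine ENNReal.ofReal_le_ofReal ?_
    set M := pmfMean (H.randomRRSet T τ) (increment t) * (Real.exp c - 1) with hM
    have : ∀ R, Real.exp (c * addRR est R t + m * M) =
        Real.exp (c * est t + m * M) * Real.exp (c * increment t R) := by
      intro R; rw [← Real.exp_add, addRR_apply]; ring_nf
    simp only [this, pmfMean_const_mul]
    refine (mul_le_mul_of_nonneg_left (pmfMean_exp_le _ (increment_nonneg t) (increment_le_one t) c)
      (Real.exp_pos _).le).trans (le_of_eq ?_)
    rw [← hM, ← Real.exp_add]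
    push_cast
    ring_nf

/-- Chernoff's method; the sign of `c` selects the tail. -/
theorem sampleRR_tail_le (H : Network V) (T : Finset V) (τ : Termination) (t : T) (c a : ℝ)
    (m : ℕ) :
    (H.sampleRR T τ m 0).toOuterMeasure {x | a ≤ c * x t} ≤
      ENNReal.ofReal (Real.exp
        (m * (pmfMean (H.randomRRSet T τ) (increment t) * (Real.exp c - 1)) - a)) := by
  refine (PMF.toOuterMeasure_le_tsum _ _
    (fun x => ENNReal.ofReal (Real.exp (c * x t)) * ENNReal.ofReal (Real.exp (-a))) ?_).trans ?_
  · intro x hx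
    rw [← ENNReal.ofReal_mul (Real.exp_pos _).le, ← Real.exp_add, ENNReal.one_le_ofReal,
      Real.one_le_exp_iff]
    have : a ≤ c * x t := hx
    linarith
  · rw [tsum_congr fun x => (mul_assoc _ _ _).symm, ENNReal.tsum_mul_right]
    refine (mul_le_mul_left (tsum_sampleRR_exp_le H T τ t c m 0) _).trans (le_of_eq ?_)
    rw [← ENNReal.ofReal_mul (Real.exp_pos _).le, ← Real.exp_add]
    rw [Pi.zero_apply, mul_zero, zero_add, ← sub_eq_add_neg]

/-- The mean enters the exponent with the factor `exp c - 1 - c ≥ 0`, so it may be replaced there by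
the larger `ν`. -/
theorem sampleRR_upper_tail_le (H : Network V) (T : Finset V) (τ : Termination) (t : T) (m : ℕ)
    {ν δ : ℝ} (hν : pmfMean (H.randomRRSet T τ) (increment t) ≤ ν) (hδ : 0 < δ) :
    (H.sampleRR T τ m 0).toOuterMeasure
        {x | m * (pmfMean (H.randomRRSet T τ) (increment t) + δ * ν) ≤ x t} ≤
      ENNReal.ofReal (Real.exp (-(m * (δ ^ 2 * ν / (2 + 2 / 3 * δ))))) := by
  set μ := pmfMean (H.randomRRSet T τ) (increment t) with hμ
  have hμ0 : 0 ≤ μ := pmfMean_nonneg _ (increment_nonneg t)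
  -- Bernstein's choice, below `3` for every `δ`. With `q = δ²/(2 + 2δ/3)` it gives `c²/(2(1 - c/3))
  -- = q` and `c * δ = 2q`, leaving `-q`.
  set c := δ / (1 + δ / 3) with hc
  have hd : 0 < 1 + δ / 3 := by positivity
  have hc0 : 0 < c := by positivity
  have hc3 : c < 3 := by rw [hc, div_lt_iff₀ hd]; linarith
  have hexp := Real.exp_le_one_add_add_sq_div hc0.le hc3
  have hexp0 := Real.add_one_le_exp c
  have hkey : Real.exp c - 1 - c - c * δ ≤ -(δ ^ 2 / (2 + 2 / 3 * δ)) := by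
    have h1 : c ^ 2 / (2 * (1 - c / 3)) = δ ^ 2 / (2 + 2 / 3 * δ) := by
      have : 1 - c / 3 = 1 / (1 + δ / 3) := by rw [hc]; field_simp; ring
      rw [this, hc]; field_simp
    have h2 : c * δ = 2 * (δ ^ 2 / (2 + 2 / 3 * δ)) := by
      rw [hc]; field_simp
    linarith
  refine (MeasureTheory.measure_mono ?_ : _ ≤ (H.sampleRR T τ m 0).toOuterMeasure
    {x | c * (m * (μ + δ * ν)) ≤ c * x t}).trans ((sampleRR_tail_le H T τ t c _ m).trans ?_)
  · intro x hx
    exact mul_le_mul_of_nonneg_left hx hc0.le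
  · refine ENNReal.ofReal_le_ofReal (Real.exp_le_exp.2 ?_)
    rw [← hμ]
    have h3 : μ * (Real.exp c - 1 - c) ≤ ν * (Real.exp c - 1 - c) :=
      mul_le_mul_of_nonneg_right hν (by linarith)
    have h4 := mul_le_mul_of_nonneg_left hkey (hμ0.trans hν)
    have h5 : (m : ℝ) * (μ * (Real.exp c - 1 - c) - c * δ * ν) ≤
        m * (ν * -(δ ^ 2 / (2 + 2 / 3 * δ))) :=
      mul_le_mul_of_nonneg_left (by linarith) (Nat.cast_nonneg m)
    calc _ = (m : ℝ) * (μ * (Real.exp c - 1 - c) - c * δ * ν) := by ring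
      _ ≤ _ := h5
      _ = _ := by ring

/-- Taking `c = -δ` yields the exponent `δ²ν/2`, weakened here to match the upper tail. -/
theorem sampleRR_lower_tail_le (H : Network V) (T : Finset V) (τ : Termination) (t : T) (m : ℕ)
    {ν δ : ℝ} (hν : pmfMean (H.randomRRSet T τ) (increment t) ≤ ν) (hδ : 0 < δ) :
    (H.sampleRR T τ m 0).toOuterMeasure
        {x | x t ≤ m * (pmfMean (H.randomRRSet T τ) (increment t) - δ * ν)} ≤
      ENNReal.ofReal (Real.exp (-(m * (δ ^ 2 * ν / (2 + 2 / 3 * δ))))) := by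
  set μ := pmfMean (H.randomRRSet T τ) (increment t) with hμ
  have hμ0 : 0 ≤ μ := pmfMean_nonneg _ (increment_nonneg t)
  have hexp := Real.exp_neg_le_one_sub_add_sq_div_two hδ.le
  refine (MeasureTheory.measure_mono ?_ : _ ≤ (H.sampleRR T τ m 0).toOuterMeasure
    {x | -δ * (m * (μ - δ * ν)) ≤ -δ * x t}).trans ((sampleRR_tail_le H T τ t (-δ) _ m).trans ?_)
  · intro x hx
    have hx' : x t ≤ m * (μ - δ * ν) := hx
    exact mul_le_mul_of_nonpos_left hx' (neg_nonpos.2 hδ.le)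
  · refine ENNReal.ofReal_le_ofReal (Real.exp_le_exp.2 ?_)
    rw [← hμ]
    have h1 : μ * (Real.exp (-δ) - 1 + δ) ≤ ν * (δ ^ 2 / 2) :=
      mul_le_mul hν (by linarith) (by linarith [Real.add_one_le_exp (-δ)]) (hμ0.trans hν)
    have h2 : δ ^ 2 * ν / (2 + 2 / 3 * δ) ≤ δ ^ 2 * ν / 2 :=
      div_le_div_of_nonneg_left (mul_nonneg (sq_nonneg δ) (hμ0.trans hν)) two_pos (by linarith)
    have h3 : (m : ℝ) * (μ * (Real.exp (-δ) - 1 + δ) - δ ^ 2 * ν) ≤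
        m * -(δ ^ 2 * ν / (2 + 2 / 3 * δ)) :=
      mul_le_mul_of_nonneg_left (by linarith) (Nat.cast_nonneg m)
    calc _ = (m : ℝ) * (μ * (Real.exp (-δ) - 1 + δ) - δ ^ 2 * ν) := by ring
      _ ≤ _ := h3
      _ = _ := by ring

end Network

end

/-! ### Union bounds for the two phases. -/

noncomputable section

/-- Inside `A` failure is bounded by `1`, outside by `F`. The last sum runs over all outcomes, so no
conditional law is needed. -/
theorem PMF.toOuterMeasure_bind_le {α β : Type*} (p : PMF α) (f : α → PMF β) (s : Set β)
    (A : Set α) (F : α → ENNReal) (h : ∀ a ∉ A, (f a).toOuterMeasure s ≤ F a) :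
    (p.bind f).toOuterMeasure s ≤ p.toOuterMeasure A + ∑' a, p a * F a := by
  rw [PMF.toOuterMeasure_bind_apply, PMF.toOuterMeasure_apply, ← ENNReal.tsum_add]
  refine ENNReal.tsum_le_tsum fun a => ?_
  by_cases ha : a ∈ A
  · rw [Set.indicator_of_mem ha]
    refine le_add_right ?_
    calc p a * (f a).toOuterMeasure s ≤ p a * (f a).toOuterMeasure Set.univ := by
          gcongr; exact Set.subset_univ s
      _ = p a := by
          rw [((f a).toOuterMeasure_apply_eq_one_iff _).2 (Set.subset_univ _), mul_one]
  · rw [Set.indicator_of_notMem ha, zero_add]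
    gcongr
    exact h a ha

namespace Network

/-! ### The `k`-th largest value -/

section KthLargest

variable {ι : Type*} [Fintype ι] {k : ℕ} (f : ι → ℝ)

theorem bddAbove_kthLargest :
    BddAbove {x | x ∈ Set.range f ∧ k ≤ #(univ.filter fun t => x ≤ f t)} :=
  ((Set.finite_range f).subset fun _ h => h.1).bddAbove

/-- Otherwise the least of these values would compete in the supremum. -/
theorem card_kthLargest_lt (hk : 1 ≤ k) : #(univ.filter fun t => kthLargest k f < f t) < k := by
  by_contra! h
  obtain ⟨m, hm, hmin⟩ := Finset.exists_min_image (univ.filter fun t => kthLargest k f < f t) f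
    (Finset.card_pos.1 (hk.trans h))
  refine absurd (le_csSup (bddAbove_kthLargest f) (a := f m) ⟨⟨m, rfl⟩, h.trans ?_⟩)
    (not_le_of_gt (mem_filter.1 hm).2)
  exact Finset.card_le_card fun t ht => mem_filter.2 ⟨mem_univ _, hmin t ht⟩

theorem le_card_kthLargest_le (hk : 1 ≤ k) (hkι : k ≤ Fintype.card ι) :
    k ≤ #(univ.filter fun t => kthLargest k f ≤ f t) := by
  have hne : (univ : Finset ι).Nonempty := Finset.card_pos.1 (hk.trans hkι)
  obtain ⟨m, -, hmin⟩ := Finset.exists_min_image univ f hne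
  have hmem : f m ∈ {x | x ∈ Set.range f ∧ k ≤ #(univ.filter fun t => x ≤ f t)} := by
    refine ⟨⟨m, rfl⟩, hkι.trans (le_of_eq ?_)⟩
    rw [Finset.filter_true_of_mem hmin, Finset.card_univ]
  exact (Set.Nonempty.csSup_mem ⟨_, hmem⟩ ((Set.finite_range f).subset fun _ h => h.1)).2

/-- Some index is among the `k` largest for `g` without exceeding the `k`-th largest for `f`. -/
theorem exists_kthLargest_le (g : ι → ℝ) (hk : 1 ≤ k) (hkι : k ≤ Fintype.card ι) :
    ∃ t, f t ≤ kthLargest k f ∧ kthLargest k g ≤ g t := by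
  by_contra! h
  refine absurd ((le_card_kthLargest_le g hk hkι).trans (Finset.card_le_card ?_))
    (not_le_of_gt (card_kthLargest_lt f hk))
  intro t ht
  refine mem_filter.2 ⟨mem_univ _, lt_of_not_ge fun h' => ?_⟩
  exact absurd (mem_filter.1 ht).2 (not_le_of_gt (h t h'))

end KthLargest

variable {V : Type*} [DecidableEq V] [Fintype V]

/-! ### The threshold loop -/

/-- `θ` is sized for the scale `x`, and a larger scale `n' * ν` only improves the exponent. Serves
both phases, with `x = x_i` and `x = LB`. -/
theorem exp_neg_sample_le {n' θ : ℕ} {ε x ν L : ℝ} (hn : 0 < n') (hε : 0 < ε) (hx : 0 < x)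
    (hL : 0 ≤ L) (hν : x ≤ n' * ν)
    (hθ : (n' * (2 + 2 / 3 * ε)) / (ε ^ 2 * x) * L ≤ θ) :
    Real.exp (-(θ * (ε ^ 2 * ν / (2 + 2 / 3 * ε)))) ≤ Real.exp (-L) := by
  refine Real.exp_le_exp.2 (neg_le_neg ?_)
  have hn' : (0 : ℝ) < n' := Nat.cast_pos.2 hn
  have hν0 : 0 < ν := pos_of_mul_pos_right (hx.trans_le hν) hn'.le
  calc L ≤ L * (n' * ν / x) := le_mul_of_one_le_right hL ((one_le_div hx).2 hν)
    _ = (n' * (2 + 2 / 3 * ε)) / (ε ^ 2 * x) * L * (ε ^ 2 * ν / (2 + 2 / 3 * ε)) := by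
        field_simp
    _ ≤ θ * (ε ^ 2 * ν / (2 + 2 / 3 * ε)) := by gcongr

theorem xThr_pos {n' : ℕ} (hn : 0 < n') (i : ℕ) : 0 < xThr n' i := by
  unfold xThr; positivity

/-- The logarithmic factor of the sample sizes of the first phase. -/
def logFactor (n' m : ℕ) (l : ℝ) : ℝ :=
  l * Real.log n' + Real.log m + Real.log (Real.logb 2 n') + Real.log 2

theorem one_le_logb_two {n' : ℕ} (hn : 2 ≤ n') : 1 ≤ Real.logb 2 n' := by
  rw [Real.le_logb_iff_rpow_le one_lt_two (by positivity), Real.rpow_one]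
  exact_mod_cast hn

theorem logFactor_pos {n' m : ℕ} {l : ℝ} (hn : 2 ≤ n') (hl : 0 < l) :
    0 < logFactor n' m l := by
  have h1 : 0 ≤ Real.log n' := Real.log_natCast_nonneg _
  have h2 : 0 ≤ Real.log m := Real.log_natCast_nonneg _
  have h3 : 0 ≤ Real.log (Real.logb 2 n') := Real.log_nonneg (one_le_logb_two hn)
  have h4 : 0 < Real.log 2 := Real.log_pos one_lt_two
  unfold logFactor
  positivity

theorem mul_exp_neg_logFactor {n' m : ℕ} {l : ℝ} (hn : 2 ≤ n') (hm : 1 ≤ m) :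
    (m : ℝ) * Real.exp (-logFactor n' m l) = 1 / (2 * (n' : ℝ) ^ l * Real.logb 2 n') := by
  have h1 : (0 : ℝ) < n' := by positivity
  have h2 : (0 : ℝ) < m := by positivity
  have h3 : 0 < Real.logb 2 n' := one_pos.trans_le (one_le_logb_two hn)
  rw [Real.exp_neg, logFactor, Real.exp_add, Real.exp_add, Real.exp_add, Real.exp_log h2,
    Real.exp_log h3, Real.exp_log two_pos, mul_comm l, ← Real.rpow_def_of_pos h1]
  have := Real.rpow_pos_of_pos h1 l
  field_simp

/-- Makes the truncated differences `θ_i - θ_{i-1}` genuine, so that successive batches add up to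
`θ_i`. -/
theorem thetaPhase1_mono {n' m : ℕ} {ε' l : ℝ} (hn : 2 ≤ n') (hl : 0 < l)
    (hε : 0 < ε') (i : ℕ) : thetaPhase1 n' m ε' l i ≤ thetaPhase1 n' m ε' l (i + 1) := by
  rcases Nat.eq_zero_or_pos i with rfl | hi
  · simp [thetaPhase1]
  · rw [thetaPhase1, thetaPhase1, if_neg hi.ne', if_neg (Nat.succ_ne_zero i)]
    have hL := (logFactor_pos (m := m) hn hl).le
    rw [logFactor] at hL
    have hx := xThr_pos (two_pos.trans_le hn) (i + 1)
    have hle : xThr n' (i + 1) ≤ xThr n' i := by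
      unfold xThr
      gcongr
      · norm_num
      · omega
    gcongr

/-- A round of the loop whose estimate exceeds `(1 + ε') max(x_i, Shap^(k))` is unlikely. -/
theorem round_fail_le (G : Network V) (T : Finset V) (τ : Termination) {ε' l : ℝ} {k : ℕ}
    (hn : 2 ≤ #(univ \ T)) (hε : 0 < ε') (hl : 0 < l) (hk1 : 1 ≤ k) (hkT : k ≤ #T) (i : ℕ) :
    ((G.removeSeedIn T).sampleRR T τ (thetaPhase1 #(univ \ T) #T ε' l (i + 1)) 0).toOuterMeasure
      {x | (1 + ε') * max (xThr #(univ \ T) (i + 1)) (kthLargest k (G.shap T τ)) ≤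
        #(univ \ T) * (kthLargest k x / thetaPhase1 #(univ \ T) #T ε' l (i + 1))} ≤
      ENNReal.ofReal (1 / (2 * (#(univ \ T) : ℝ) ^ l * Real.logb 2 #(univ \ T))) := by
  set n' := #(univ \ T)
  set θ := thetaPhase1 n' #T ε' l (i + 1) with hθ
  set y := max (xThr n' (i + 1)) (kthLargest k (G.shap T τ)) with hy
  have hx := xThr_pos (two_pos.trans_le hn) (i + 1)
  have hxy : xThr n' (i + 1) ≤ y := le_max_left _ _
  have hm : 1 ≤ #T := hk1.trans hkT
  have hn0 : (0 : ℝ) < n' := by positivity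
  have hL := logFactor_pos (m := #T) hn hl
  have hceil : (n' * (2 + 2 / 3 * ε')) / (ε' ^ 2 * xThr n' (i + 1)) * logFactor n' #T l ≤ θ := by
    rw [hθ, thetaPhase1, if_neg (Nat.succ_ne_zero i)]
    exact Nat.le_ceil _
  have hθ0 : (0 : ℝ) < θ := lt_of_lt_of_le (by positivity) hceil
  have hν : xThr n' (i + 1) ≤ n' * (y / n') := by rwa [mul_div_cancel₀ _ hn0.ne']
  have hbound : ∀ t : T, ((G.removeSeedIn T).sampleRR T τ θ 0).toOuterMeasure
      {x | G.shap T τ t ≤ kthLargest k (G.shap T τ) ∧ θ * ((1 + ε') * (y / n')) ≤ x t} ≤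
      ENNReal.ofReal (Real.exp (-logFactor n' #T l)) := by
    intro t
    by_cases ht : G.shap T τ t ≤ kthLargest k (G.shap T τ)
    · have hμ : pmfMean ((G.removeSeedIn T).randomRRSet T τ) (increment t) ≤ y / n' := by
        rw [le_div_iff₀ hn0, mul_comm, ← shap_eq_mul_pmfMean]
        exact ht.trans (le_max_right _ _)
      refine (MeasureTheory.measure_mono ?_).trans
        ((sampleRR_upper_tail_le (G.removeSeedIn T) T τ t θ hμ hε).trans
          (ENNReal.ofReal_le_ofReal
            (exp_neg_sample_le (two_pos.trans_le hn) hε hx hL.le hν hceil)))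
      rintro x ⟨-, hx⟩
      refine le_trans (mul_le_mul_of_nonneg_left ?_ hθ0.le) hx
      linarith
    · simp [ht]
  calc _ ≤ ((G.removeSeedIn T).sampleRR T τ θ 0).toOuterMeasure
        (⋃ t : T, {x | G.shap T τ t ≤ kthLargest k (G.shap T τ) ∧
          θ * ((1 + ε') * (y / n')) ≤ x t}) := by
        refine MeasureTheory.measure_mono fun x hx => ?_
        -- A seed with `Shap(t) ≤ Shap^(k)` must have a counter at least `est^(k)`; this is an upper
        -- deviation on the scale `y`.
        obtain ⟨t, ht, hxt⟩ := exists_kthLargest_le (G.shap T τ) x hk1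
          (by rwa [Fintype.card_coe])
        refine Set.mem_iUnion.2 ⟨t, ht, le_trans ?_ hxt⟩
        have hx' : (1 + ε') * y ≤ n' * (kthLargest k x / θ) := hx
        calc (θ : ℝ) * ((1 + ε') * (y / n')) = θ / n' * ((1 + ε') * y) := by ring
          _ ≤ θ / n' * (n' * (kthLargest k x / θ)) := by gcongr
          _ = kthLargest k x := by field_simp
    _ ≤ ∑ t : T, ENNReal.ofReal (Real.exp (-logFactor n' #T l)) :=
        (MeasureTheory.measure_iUnion_fintype_le _ _).trans (Finset.sum_le_sum fun t _ => hbound t)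
    _ = ENNReal.ofReal (#T * Real.exp (-logFactor n' #T l)) := by
        rw [Finset.sum_const, Finset.card_univ, Fintype.card_coe, nsmul_eq_mul,
          ENNReal.ofReal_mul (Nat.cast_nonneg _), ENNReal.ofReal_natCast]
    _ = _ := by rw [mul_exp_neg_logFactor hn hm]

/-- The counters start from their unconditional law after `θ_i` samples. Never conditioning on
earlier rounds lets the bound for independent samples apply in each round. -/
theorem thresholdLoop_fail_le (G : Network V) (T : Finset V) (τ : Termination) {ε' l : ℝ} {k : ℕ}
    (hn : 2 ≤ #(univ \ T)) (hε : 0 < ε') (hl : 0 < l) (hk1 : 1 ≤ k) (hkT : k ≤ #T)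
    (hShap : 1 ≤ kthLargest k (G.shap T τ)) (r i : ℕ) :
    (((G.removeSeedIn T).sampleRR T τ (thetaPhase1 #(univ \ T) #T ε' l i) 0).bind
      ((G.removeSeedIn T).thresholdLoop T τ ε' l k r (i + 1))).toOuterMeasure
        {LB | ¬ (0 < LB ∧ LB ≤ kthLargest k (G.shap T τ))} ≤
      r * ENNReal.ofReal (1 / (2 * (#(univ \ T) : ℝ) ^ l * Real.logb 2 #(univ \ T))) := by
  induction r generalizing i with
  | zero =>
    simp only [Nat.cast_zero, zero_mul, nonpos_iff_eq_zero, PMF.toOuterMeasure_bind_apply,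
      ENNReal.tsum_eq_zero]
    intro x
    -- Without an exit `LB = 1`, which is admissible because `Shap^(k) ≥ 1`.
    rw [thresholdLoop, PMF.toOuterMeasure_pure_apply, if_neg (by simp [hShap]), mul_zero]
  | succ r ih =>
    have hmono := thetaPhase1_mono (m := #T) hn hl hε i
    have hround := round_fail_le G T τ hn hε hl hk1 hkT i
    have hx := xThr_pos (two_pos.trans_le hn) (i + 1)
    have hstep : ((G.removeSeedIn T).sampleRR T τ (thetaPhase1 #(univ \ T) #T ε' l i) 0).bind
        ((G.removeSeedIn T).thresholdLoop T τ ε' l k (r + 1) (i + 1)) =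
        ((G.removeSeedIn T).sampleRR T τ (thetaPhase1 #(univ \ T) #T ε' l (i + 1)) 0).bind
          fun est' => if (1 + ε') * xThr #(univ \ T) (i + 1) ≤ #(univ \ T) *
              (kthLargest k est' / thetaPhase1 #(univ \ T) #T ε' l (i + 1)) then
            PMF.pure (#(univ \ T) * (kthLargest k est' /
              (thetaPhase1 #(univ \ T) #T ε' l (i + 1) * (1 + ε'))))
          else (G.removeSeedIn T).thresholdLoop T τ ε' l k r (i + 2) est' := by
      conv_rhs => rw [← Nat.add_sub_cancel' hmono, sampleRR_add, PMF.bind_bind]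
      simp only [thresholdLoop, Nat.add_sub_cancel, Nat.add_sub_cancel' hmono]
    rw [hstep, Nat.cast_succ, add_one_mul (r : ENNReal), add_comm ((r : ENNReal) * _)]
    refine (PMF.toOuterMeasure_bind_le _ _ _ _ (fun est' =>
      ((G.removeSeedIn T).thresholdLoop T τ ε' l k r (i + 2) est').toOuterMeasure
        {LB | ¬ (0 < LB ∧ LB ≤ kthLargest k (G.shap T τ))}) ?_).trans
      (add_le_add hround ?_)
    · intro est' hest
      have hest : #(univ \ T) * (kthLargest k est' / thetaPhase1 #(univ \ T) #T ε' l (i + 1)) <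
        (1 + ε') * max (xThr #(univ \ T) (i + 1)) (kthLargest k (G.shap T τ)) := lt_of_not_ge hest
      split_ifs with hexit
      -- Exit and no failure give `x_{i+1} < max(x_{i+1}, Shap^(k))`. So the maximum is `Shap^(k)`,
      -- and `hest` bounds `LB` by it.
      · have hmax := (mul_lt_mul_iff_right₀ (by positivity : (0 : ℝ) < 1 + ε')).1
          (hexit.trans_lt hest)
        have hmax' : max (xThr #(univ \ T) (i + 1)) (kthLargest k (G.shap T τ)) =
            kthLargest k (G.shap T τ) := max_eq_right ((lt_max_iff.1 hmax).resolve_left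
              (lt_irrefl _)).le
        rw [hmax'] at hest
        rw [PMF.toOuterMeasure_pure_apply, if_neg]
        · exact zero_le
        · refine not_not.2 ?_
          rw [← div_div, ← mul_div_assoc]
          refine ⟨div_pos (lt_of_lt_of_le (by positivity) hexit) (by positivity), ?_⟩
          rw [div_le_iff₀ (by positivity), mul_comm _ (1 + ε')]
          exact hest.le
      · exact le_rfl
    · rw [← PMF.toOuterMeasure_bind_apply]
      exact ih (i + 1)

theorem estimateThreshold_fail_le (G : Network V) (T : Finset V) (τ : Termination) {ε l : ℝ}
    {k : ℕ} (hε : 0 < ε) (hl : 0 < l) (hk1 : 1 ≤ k) (hkT : k ≤ #T)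
    (hShap : 1 ≤ kthLargest k (G.shap T τ)) :
    ((G.removeSeedIn T).estimateThreshold T τ ε l k).toOuterMeasure
        {LB | ¬ (0 < LB ∧ LB ≤ kthLargest k (G.shap T τ))} ≤
      ENNReal.ofReal (1 / (2 * (#(univ \ T) : ℝ) ^ l)) := by
  rw [estimateThreshold]
  rcases Nat.lt_or_ge #(univ \ T) 2 with hn | hn
  · rw [Nat.log_of_lt hn, thresholdLoop, PMF.toOuterMeasure_pure_apply, if_neg (by simp [hShap])]
    exact zero_le
  · have h := thresholdLoop_fail_le G T τ hn (ε' := Real.sqrt 2 * ε) (by positivity) hl hk1 hkT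
      hShap (Nat.log 2 #(univ \ T) - 1) 0
    rw [show thetaPhase1 #(univ \ T) #T (Real.sqrt 2 * ε) l 0 = 0 from if_pos rfl, sampleRR,
      PMF.pure_bind] at h
    refine h.trans ?_
    rw [← ENNReal.ofReal_natCast, ← ENNReal.ofReal_mul (Nat.cast_nonneg _)]
    refine ENNReal.ofReal_le_ofReal ?_
    have hb := one_le_logb_two hn
    -- The `log₂ n'` in the error of a round pays for the union over rounds.
    have hlog : ((Nat.log 2 #(univ \ T) - 1 : ℕ) : ℝ) ≤ Real.logb 2 #(univ \ T) :=
      (Nat.cast_le.2 (Nat.sub_le _ _)).trans (Real.natLog_le_logb _ _)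
    have hp : (0 : ℝ) < (#(univ \ T) : ℝ) ^ l := Real.rpow_pos_of_pos (by positivity) l
    calc _ ≤ Real.logb 2 #(univ \ T) *
          (1 / (2 * (#(univ \ T) : ℝ) ^ l * Real.logb 2 #(univ \ T))) := by gcongr
      _ = _ := by field_simp

/-! ### The second phase -/

/-- Used with `s = max(Shap(t), Shap^(k))`, which merges the two cases of the guarantee. The `log 4`
in `θ` turns the two tails into the factor `1/2`. -/
theorem estimate_fail_le (G : Network V) (T : Finset V) (τ : Termination) {ε l LB s : ℝ}
    (hn : 1 ≤ #(univ \ T)) (hm : 1 ≤ #T) (hε : 0 < ε) (hl : 0 < l) (hLB : 0 < LB) (hs : LB ≤ s)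
    (t : T) (hts : G.shap T τ t ≤ s) :
    ((G.removeSeedIn T).sampleRR T τ (thetaPhase2 #(univ \ T) #T ε l LB) 0).toOuterMeasure
      {x | ε * s < |#(univ \ T) * (x t / thetaPhase2 #(univ \ T) #T ε l LB) - G.shap T τ t|} ≤
      ENNReal.ofReal (1 / (2 * (#(univ \ T) : ℝ) ^ l * #T)) := by
  set n' := #(univ \ T)
  set θ := thetaPhase2 n' #T ε l LB with hθ
  set L := l * Real.log n' + Real.log #T + Real.log 4 with hL
  have hn0 : (0 : ℝ) < n' := by positivity
  have hm0 : (0 : ℝ) < #T := by positivity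
  have hL0 : 0 < L := by
    have h1 : 0 ≤ Real.log n' := Real.log_natCast_nonneg _
    have h2 : 0 ≤ Real.log #T := Real.log_natCast_nonneg _
    have h4 : 0 < Real.log 4 := Real.log_pos (by norm_num)
    positivity
  have hceil : (n' * (2 + 2 / 3 * ε)) / (ε ^ 2 * LB) * L ≤ θ := Nat.le_ceil _
  have hθ0 : (0 : ℝ) < θ := lt_of_lt_of_le (by positivity) hceil
  have hshap := shap_eq_mul_pmfMean G T τ t
  set μ := pmfMean ((G.removeSeedIn T).randomRRSet T τ) (increment t) with hμ
  have hμs : μ ≤ s / n' := by rwa [le_div_iff₀ hn0, mul_comm, ← hshap]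
  have hexp := exp_neg_sample_le (ν := s / n') hn hε hLB hL0.le
    (by rwa [mul_div_cancel₀ _ hn0.ne']) hceil
  calc _ ≤ ((G.removeSeedIn T).sampleRR T τ θ 0).toOuterMeasure
        ({x | θ * (μ + ε * (s / n')) ≤ x t} ∪ {x | x t ≤ θ * (μ - ε * (s / n'))}) := by
        refine MeasureTheory.measure_mono fun x hx => ?_
        have hx' : ε * s < |n' * (x t / θ) - G.shap T τ t| := hx
        rw [hshap] at hx'
        have e1 : x t = θ / n' * (n' * (x t / θ)) := by field_simp
        rcases lt_abs.1 hx' with h | h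
        · left
          change θ * (μ + ε * (s / n')) ≤ x t
          rw [e1]
          calc (θ : ℝ) * (μ + ε * (s / n')) = θ / n' * (n' * μ + ε * s) := by
                rw [div_mul_eq_mul_div, mul_div_assoc, add_div, mul_div_cancel_left₀ _ hn0.ne',
                  mul_div_assoc]
            _ ≤ _ := mul_le_mul_of_nonneg_left (by linarith) (div_nonneg hθ0.le hn0.le)
        · right
          change x t ≤ θ * (μ - ε * (s / n'))
          rw [e1]
          calc θ / n' * (n' * (x t / θ)) ≤ θ / n' * (n' * μ - ε * s) :=
                mul_le_mul_of_nonneg_left (by linarith) (div_nonneg hθ0.le hn0.le)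
            _ = _ := by
                rw [div_mul_eq_mul_div, mul_div_assoc, sub_div, mul_div_cancel_left₀ _ hn0.ne',
                  mul_div_assoc]
    _ ≤ ENNReal.ofReal (Real.exp (-L)) + ENNReal.ofReal (Real.exp (-L)) :=
        (MeasureTheory.measure_union_le _ _).trans (add_le_add
          ((sampleRR_upper_tail_le _ T τ t θ hμs hε).trans (ENNReal.ofReal_le_ofReal hexp))
          ((sampleRR_lower_tail_le _ T τ t θ hμs hε).trans (ENNReal.ofReal_le_ofReal hexp)))
    _ = _ := by
        rw [← ENNReal.ofReal_add (Real.exp_pos _).le (Real.exp_pos _).le]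
        congr 1
        rw [Real.exp_neg, hL, Real.exp_add, Real.exp_add, Real.exp_log hm0,
          Real.exp_log (by norm_num), mul_comm l, ← Real.rpow_def_of_pos hn0]
        have := Real.rpow_pos_of_pos hn0 l
        field_simp
        norm_num

/-- The estimates required by the approximation guarantee. -/
def accurateEstimates (G : Network V) (T : Finset V) (τ : Termination) (ε : ℝ) (k : ℕ) :
    Set (T → ℝ) :=
  {est | ∀ t : T,
    (kthLargest k (G.shap T τ) < G.shap T τ t →
      |est t - G.shap T τ t| ≤ ε * G.shap T τ t) ∧
    (G.shap T τ t ≤ kthLargest k (G.shap T τ) →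
      |est t - G.shap T τ t| ≤ ε * kthLargest k (G.shap T τ))}

theorem phase2_fail_le (G : Network V) (T : Finset V) (τ : Termination) {ε l LB : ℝ} {k : ℕ}
    (hn : 1 ≤ #(univ \ T)) (hm : 1 ≤ #T) (hε : 0 < ε) (hl : 0 < l) (hLB : 0 < LB)
    (hLBk : LB ≤ kthLargest k (G.shap T τ)) :
    (((G.removeSeedIn T).sampleRR T τ (thetaPhase2 #(univ \ T) #T ε l LB) 0).map
      fun est t => (#(univ \ T) : ℝ) * (est t / thetaPhase2 #(univ \ T) #T ε l LB)).toOuterMeasure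
        (G.accurateEstimates T τ ε k)ᶜ ≤
      ENNReal.ofReal (1 / (2 * (#(univ \ T) : ℝ) ^ l)) := by
  set σ := kthLargest k (G.shap T τ)
  have hm0 : (0 : ℝ) < #T := by positivity
  have hp : (0 : ℝ) < (#(univ \ T) : ℝ) ^ l := Real.rpow_pos_of_pos (by positivity) l
  rw [PMF.toOuterMeasure_map_apply]
  calc _ ≤ ((G.removeSeedIn T).sampleRR T τ (thetaPhase2 #(univ \ T) #T ε l LB) 0).toOuterMeasure
        (⋃ t : T, {x | ε * max (G.shap T τ t) σ <
          |#(univ \ T) * (x t / thetaPhase2 #(univ \ T) #T ε l LB) - G.shap T τ t|}) := by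
        refine MeasureTheory.measure_mono fun x hx => ?_
        by_contra hcon
        simp only [Set.mem_iUnion, Set.mem_ofPred_eq, not_exists, not_lt] at hcon
        refine hx fun t => ⟨fun h => ?_, fun h => ?_⟩
        · have := hcon t; rwa [max_eq_left h.le] at this
        · have := hcon t; rwa [max_eq_right h] at this
    _ ≤ ∑ t : T, ENNReal.ofReal (1 / (2 * (#(univ \ T) : ℝ) ^ l * #T)) :=
        (MeasureTheory.measure_iUnion_fintype_le _ _).trans (Finset.sum_le_sum fun t _ =>
          estimate_fail_le G T τ hn hm hε hl hLB (hLBk.trans (le_max_right _ _)) t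
            (le_max_left _ _))
    _ = _ := by
        rw [Finset.sum_const, Finset.card_univ, Fintype.card_coe, nsmul_eq_mul,
          ← ENNReal.ofReal_natCast, ← ENNReal.ofReal_mul (Nat.cast_nonneg _)]
        congr 1
        field_simp

theorem approxRRset_fail_le (G : Network V) (T : Finset V) (τ : Termination) {ε l : ℝ} {k : ℕ}
    (hn : 1 ≤ #(univ \ T)) (hε : 0 < ε) (hl : 0 < l) (hk1 : 1 ≤ k) (hkT : k ≤ #T)
    (hShap : 1 ≤ kthLargest k (G.shap T τ)) :
    (G.approxRRset T τ ε l k).toOuterMeasure (G.accurateEstimates T τ ε k)ᶜ ≤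
      ENNReal.ofReal (1 / (#(univ \ T) : ℝ) ^ l) := by
  have hp : (0 : ℝ) < (#(univ \ T) : ℝ) ^ l := Real.rpow_pos_of_pos (by positivity) l
  refine (PMF.toOuterMeasure_bind_le _ _ _ {LB | ¬ (0 < LB ∧ LB ≤ kthLargest k (G.shap T τ))}
    (fun _ => ENNReal.ofReal (1 / (2 * (#(univ \ T) : ℝ) ^ l))) ?_).trans
    ((add_le_add_left (estimateThreshold_fail_le G T τ hε hl hk1 hkT hShap) _).trans ?_)
  · intro LB hLB
    obtain ⟨h0, h1⟩ := not_not.1 hLB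
    exact phase2_fail_le G T τ hn (hk1.trans hkT) hε hl h0 h1
  · rw [ENNReal.tsum_mul_right, PMF.tsum_coe, one_mul,
      ← ENNReal.ofReal_add (by positivity) (by positivity)]
    refine le_of_eq (congrArg _ ?_)
    field_simp
    norm_num

/-- If every node were a seed, all Shapley values would vanish. -/
theorem one_le_card_of_one_le_kthLargest_shap (G : Network V) (T : Finset V) (τ : Termination)
    {k : ℕ} (hk1 : 1 ≤ k) (hkT : k ≤ #T) (hShap : 1 ≤ kthLargest k (G.shap T τ)) :
    1 ≤ #(univ \ T) := by
  by_contra h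
  have h0 : #(univ \ T) = 0 := by omega
  obtain ⟨t, -, ht⟩ := exists_kthLargest_le (G.shap T τ) (G.shap T τ) hk1
    (by rwa [Fintype.card_coe])
  rw [shap_eq_mul_pmfMean G T τ t, h0, Nat.cast_zero, zero_mul] at ht
  linarith

end Network

end

theorem mainTheorem5 {V : Type*} [Fintype V] [DecidableEq V] (G : Network V) (T : Finset V)
    (τ : Termination) (ε l : ℝ) (hε : 0 < ε) (hl : 0 < l) (k : ℕ) (hk1 : 1 ≤ k)
    (hkT : k ≤ T.card)
    (hShap : 1 ≤ Network.kthLargest k (G.shap T τ)) :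
    1 - 1 / ((Finset.univ \ T).card : ℝ) ^ l ≤
      ((G.approxRRset T τ ε l k).toOuterMeasure
        {est | ∀ t : T,
          (Network.kthLargest k (G.shap T τ) < G.shap T τ t →
            |est t - G.shap T τ t| ≤ ε * G.shap T τ t) ∧
          (G.shap T τ t ≤ Network.kthLargest k (G.shap T τ) →
            |est t - G.shap T τ t| ≤ ε * Network.kthLargest k (G.shap T τ))}).toReal := by
  have hn := G.one_le_card_of_one_le_kthLargest_shap T τ hk1 hkT hShap
  have hfail := G.approxRRset_fail_le T τ hn hε hl hk1 hkT hShap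
  set p := G.approxRRset T τ ε l k
  change _ ≤ (p.toOuterMeasure (G.accurateEstimates T τ ε k)).toReal
  set A := G.accurateEstimates T τ ε k
  have hle1 : ∀ s, p.toOuterMeasure s ≤ 1 := fun s =>
    (MeasureTheory.measure_mono (Set.subset_univ s)).trans_eq
      ((p.toOuterMeasure_apply_eq_one_iff _).2 (Set.subset_univ _))
  have htotal : 1 ≤ p.toOuterMeasure A + p.toOuterMeasure Aᶜ := by
    rw [← (p.toOuterMeasure_apply_eq_one_iff Set.univ).2 (Set.subset_univ _),
      ← Set.union_compl_self A]
    exact MeasureTheory.measure_union_le _ _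
  have hA := ne_top_of_le_ne_top ENNReal.one_ne_top (hle1 A)
  have h := ENNReal.toReal_mono (ENNReal.add_ne_top.2 ⟨hA, ENNReal.ofReal_ne_top⟩)
    (htotal.trans (add_le_add_right hfail _))
  rw [ENNReal.toReal_one, ENNReal.toReal_add hA ENNReal.ofReal_ne_top,
    ENNReal.toReal_ofReal (by positivity)] at h
  linarith
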